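/- Let $\mathcal P=[p_{ij}]$ be an $n\times n$ sign pattern (a matrix with entries in $\{+,-,0\}$) that is irreducible, combinatorially symmetric ($p_{ij}\ne 0$ if and only if $p_{ji}\neq 0$) and has zero diagonal. Its signed undirected graph $G$ has vertex set $\{1,\dots,n\}$ and an edge $\{i,j\}$ whenever $p_{ij}\neq 0$; the edge is positive if $p_{ij}p_{ji}=+$ and negative if $p_{ij}p_{ji}=-$. Suppose that $G$ is a cycle (of length $n\ge 3$). A maximal signed path in $G$ is a path with at least one edge, all of whose edges have the same sign, that cannot be prolonged at either end to a longer path whose edges all have that sign; its length is its number of edges. Call $\mathcal P$ consistent if there is an integer $k$, $0\le k\le n$, such that every real $n\times n$ matrix $A=[a_{ij}]$ with $\operatorname{sgn}(a_{ij})=p_{ij}$ for all $i,j$ has exactly $k$ real eigenvalues, counted with algebraic multiplicity. Then $\mathcal P$ is not consistent if any one of the following holds: (i) $G$ has two nonadjacent positive edges, that is, two positive edges without a common vertex; (ii) $G$ has more than one maximal signed path of odd length, that is, two maximal signed paths of odd length without a common edge (if $G$ has edges of both signs, any two different maximal signed paths have no common edge); (iii) $n$ is odd and $G$ has a positive edge.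 -/

import Mathlib

/-- An `n × n` sign pattern: a matrix with entries in `{+, -, 0}`. -/
abbrev SignPattern (n : ℕ) : Type := Matrix (Fin n) (Fin n) SignType

/-- The number of real eigenvalues of a real matrix, counted with algebraic multiplicity. -/
noncomputable def realEigenvalueCount {n : ℕ} (A : Matrix (Fin n) (Fin n) ℝ) : ℕ :=
  A.charpoly.roots.card

namespace SignPattern

variable {n : ℕ}

/-- The real matrices whose entries have the signs prescribed by `P`. -/
def qualitativeClass (P : SignPattern n) : Set (Matrix (Fin n) (Fin n) ℝ) :=
  {A | ∀ i j, SignType.sign (A i j) = P i j}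

/-- Every matrix in the qualitative class has exactly `k` real eigenvalues. -/
def IsKConsistent (P : SignPattern n) (k : ℕ) : Prop :=
  ∀ A ∈ P.qualitativeClass, realEigenvalueCount A = k

/-- `P` is `k`-consistent for some `0 ≤ k ≤ n`. -/
def IsConsistent (P : SignPattern n) : Prop :=
  ∃ k : ℕ, k ≤ n ∧ P.IsKConsistent k

/-- No simultaneous permutation of rows and columns brings `P` to block triangular form with
nontrivial square diagonal blocks. -/
def IsIrreducible (P : SignPattern n) : Prop :=
  ∀ S : Set (Fin n), S.Nonempty → S ≠ Set.univ → ∃ i ∈ S, ∃ j ∉ S, P i j ≠ 0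

/-- The zero pattern of `P` is symmetric. -/
def IsCombinatoriallySymmetric (P : SignPattern n) : Prop :=
  ∀ i j, P i j ≠ 0 ↔ P j i ≠ 0

/-- All diagonal entries of `P` are zero. -/
def HasZeroDiagonal (P : SignPattern n) : Prop :=
  ∀ i, P i i = 0

/-- The sign of `{i, j}` in the underlying signed undirected graph
(`0` if `{i, j}` is not an edge). -/
def edgeSign (P : SignPattern n) (i j : Fin n) : SignType :=
  P i j * P j i

/-- The underlying undirected graph of a combinatorially symmetric sign pattern with zero
diagonal. Its edges are signed by `edgeSign`. -/
def graph (P : SignPattern n) : SimpleGraph (Fin n) where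
  Adj i j := i ≠ j ∧ P.edgeSign i j ≠ 0
  symm := ⟨fun i j h => ⟨h.1.symm, by
    have h2 := h.2
    unfold edgeSign at h2 ⊢
    rwa [mul_comm]⟩⟩
  loopless := ⟨fun _ h => h.1 rfl⟩

/-- The underlying graph is a cycle through all the vertices (of length at least three). -/
def GraphIsCycle (P : SignPattern n) : Prop :=
  3 ≤ n ∧ Nonempty (SimpleGraph.cycleGraph n ≃g P.graph)

/-- `{i, j}` is a positively signed edge of the graph of `P`. -/
def IsPositiveEdge (P : SignPattern n) (i j : Fin n) : Prop :=
  P.graph.Adj i j ∧ P.edgeSign i j = 1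

/-- The graph of `P` has two positively signed edges with no common vertex. -/
def HasTwoNonadjacentPositiveEdges (P : SignPattern n) : Prop :=
  ∃ i j k l : Fin n, P.IsPositiveEdge i j ∧ P.IsPositiveEdge k l ∧
    i ≠ k ∧ i ≠ l ∧ j ≠ k ∧ j ≠ l

/-- `p` is a maximal signed path of sign `s` (positive for `s = 1`, negative for `s = -1`):
a path with at least one edge, all of whose edges have sign `s`, which cannot be prolonged at
either end to a longer path with these properties. -/
structure IsMaximalSignedPathOfSign (P : SignPattern n) (s : SignType) {u v : Fin n}
    (p : P.graph.Walk u v) : Prop where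
  isPath : p.IsPath
  length_pos : 0 < p.length
  sign_eq : ∀ a b, s(a, b) ∈ p.edges → P.edgeSign a b = s
  start_maximal : ∀ w, P.graph.Adj w u → w ∉ p.support → P.edgeSign w u ≠ s
  end_maximal : ∀ w, P.graph.Adj v w → w ∉ p.support → P.edgeSign v w ≠ s

/-- `p` is a maximal signed path: a maximal signed positive or a maximal signed negative path. -/
def IsMaximalSignedPath (P : SignPattern n) {u v : Fin n} (p : P.graph.Walk u v) : Prop :=
  P.IsMaximalSignedPathOfSign 1 p ∨ P.IsMaximalSignedPathOfSign (-1) p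

/-- The graph of `P`, a cycle, has more than one maximal signed path of odd length.

Running around the cycle cuts it into maximal signed paths, so two different ones have no edge in
common. If the cycle has edges of both signs, then maximal signed paths with different edge sets
are automatically edge-disjoint, and the maximal signed paths are the maximal blocks of
consecutive edges of equal sign. If all the edges have the same sign, then running around the
cycle gives a single maximal signed path, through all the vertices; it depends on the starting
point, but any two of these share an edge, and so they do not count as two. -/
def HasTwoOddMaximalSignedPaths (P : SignPattern n) : Prop :=
  ∃ (u v u' v' : Fin n) (p : P.graph.Walk u v) (q : P.graph.Walk u' v'),
    P.IsMaximalSignedPath p ∧ P.IsMaximalSignedPath q ∧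
    Odd p.length ∧ Odd q.length ∧ p.edges.Disjoint q.edges

end SignPattern

open Polynomial Filter Topology

/-! Suppose that every matrix of the class has exactly `k` real eigenvalues. Setting entries to zero
gives a limit `B` of matrices of the class whose spectrum can be easy to compute, and `B` bounds `k`
from both sides. Real roots survive limits, so `B` has at least `k` real eigenvalues; sign changes
of its characteristic polynomial on disjoint intervals survive perturbation, so `k` is at least
their number.

Keeping one directed cycle gives `X ^ n - C c` with `|c| = 1`, so `k ≤ 2`, and `k ≤ 1` for odd `n`
(`IsKConsistent.le_two`). Keeping one positive edge gives eigenvalues ±1, so `2 ≤ k`; two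
nonadjacent ones give `4 ≤ k`. This settles (i) and (iii).

For (ii) there remains even `n` with pairwise adjacent positive edges. Without positive edges, two
maximal paths would share an edge; two adjacent positive edges cut the cycle into paths of even
lengths 2 and `n - 2`. So exactly one edge is positive. An even cycle has a perfect matching
avoiding it, by negative edges only; keeping these gives `B * B = -1`, hence `k = 0`, against `2 ≤
k`. -/

/-! ### Semicontinuity of the number of real eigenvalues -/

/-- A monic real polynomial with at least `k` real roots splits over `ℂ` with the first `k`
roots real. -/
theorem Polynomial.Monic.exists_complex_roots {n k : ℕ} {p : ℝ[X]} (hp : p.Monic)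
    (hn : p.natDegree = n) (hk : k ≤ p.roots.card) :
    ∃ z : Fin n → ℂ, p.map Complex.ofRealHom = ∏ i, (X - C (z i)) ∧
      ∀ i : Fin n, (i : ℕ) < k → (z i).im = 0 := by
  set q := p.map Complex.ofRealHom with hq
  have hqm : q.Monic := hp.map _
  have hle : p.roots.map Complex.ofRealHom ≤ q.roots :=
    map_roots_le_of_injective p Complex.ofRealHom.injective
  obtain ⟨r, hr⟩ := Multiset.le_iff_exists_add.1 hle
  -- Listing the real roots first puts them at the indices below `k`.
  set l : List ℂ := p.roots.toList.map Complex.ofRealHom ++ r.toList with hl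
  have hlr : (l : Multiset ℂ) = q.roots := by
    rw [hr, hl, ← Multiset.coe_add, ← Multiset.map_coe]
    simp
  have hcard : q.roots.card = n := by
    rw [← hn, ← natDegree_map_eq_of_injective Complex.ofRealHom.injective p]
    exact (IsAlgClosed.splits q).natDegree_eq_card_roots.symm
  have hlen : l.length = n := by rw [← Multiset.coe_card, hlr, hcard]
  refine ⟨fun i => l.get (i.cast hlen.symm), ?_, fun i hi => ?_⟩
  · have h1 : q = (q.roots.map fun a => X - C a).prod := by
      simpa using ((IsAlgClosed.splits q).eq_prod_roots_of_monic hqm)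
    rw [h1, ← hlr, Multiset.map_coe, Multiset.prod_coe]
    subst hlen
    rw [← List.prod_ofFn]
    congr 1
    apply List.ext_get <;> simp
  · have h2 : (i : ℕ) < (p.roots.toList.map Complex.ofRealHom).length := by
      simpa using hi.trans_le hk
    simp only [List.get_eq_getElem, Fin.val_cast, hl]
    rw [List.getElem_append_left h2]
    simp

/-- The first `k` linear factors have real coefficients, and divisibility of real polynomials can be
tested over `ℂ`; so their product divides `p` over `ℝ`. -/
theorem Polynomial.le_card_roots_of_map_eq_prod {n k : ℕ} {p : ℝ[X]} (hp : p ≠ 0) (hkn : k ≤ n)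
    {z : Fin n → ℂ} (hz : p.map Complex.ofRealHom = ∏ i, (X - C (z i)))
    (hre : ∀ i : Fin n, (i : ℕ) < k → (z i).im = 0) : k ≤ p.roots.card := by
  set q : ℝ[X] := ∏ i : Fin k, (X - C (z (i.castLE hkn)).re) with hq
  have hdvd : q ∣ p := by
    rw [← map_dvd_map' Complex.ofRealHom, hz, hq, Polynomial.map_prod]
    have : ∀ i : Fin k, (X - C (z (i.castLE hkn)).re : ℝ[X]).map Complex.ofRealHom
        = X - C (z (i.castLE hkn)) := by
      intro i
      have : ((z (i.castLE hkn)).re : ℂ) = z (i.castLE hkn) :=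
        Complex.ext (by simp) (by simp [hre (i.castLE hkn) (by simp)])
      simp [this]
    rw [Finset.prod_congr rfl fun i _ => this i]
    refine (Finset.prod_map Finset.univ (Fin.castLEEmb hkn) fun i => X - C (z i)).symm.dvd.trans ?_
    exact Finset.prod_dvd_prod_of_subset _ _ _ (Finset.subset_univ _)
  have h1 : q.roots.card = k := by
    have h2 : q = (Finset.univ.val.map fun i : Fin k => X - C (z (i.castLE hkn)).re).prod := rfl
    have h3 : q = ((Finset.univ.val.map fun i : Fin k => (z (i.castLE hkn)).re).map
        fun a => X - C a).prod := by rw [h2, Multiset.map_map]; rfl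
    rw [h3, roots_multiset_prod_X_sub_C]
    simp
  calc k = q.roots.card := h1.symm
    _ ≤ p.roots.card := Multiset.card_le_card (roots.le_of_dvd hp hdvd)

theorem Matrix.eval_map_charpoly {n : ℕ} (A : Matrix (Fin n) (Fin n) ℝ) (x : ℂ) :
    (A.charpoly.map Complex.ofRealHom).eval x =
      (scalar (Fin n) x - A.map Complex.ofRealHom).det := by
  rw [← Matrix.charpoly_map, Matrix.eval_charpoly]

/-- The moduli of the complex eigenvalues of a matrix are at most the sum of the absolute values
of its entries. -/
theorem Matrix.norm_le_sum_abs_of_isRoot {n : ℕ} (A : Matrix (Fin n) (Fin n) ℝ) {x : ℂ}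
    (hx : (A.charpoly.map Complex.ofRealHom).IsRoot x) : ‖x‖ ≤ ∑ i, ∑ j, |A i j| := by
  rw [← Matrix.charpoly_map, ← Matrix.mem_spectrum_iff_isRoot_charpoly,
    ← Matrix.spectrum_toLin', ← Module.End.hasEigenvalue_iff_mem_spectrum] at hx
  -- Gershgorin's circle theorem.
  obtain ⟨k, hk⟩ := eigenvalue_mem_ball hx
  rw [mem_closedBall_iff_norm] at hk
  have h1 : ‖x‖ ≤ ∑ j, |A k j| := by
    rw [← Finset.add_sum_erase _ _ (Finset.mem_univ k)]
    have h2 : ‖x‖ ≤ ‖x - A.map Complex.ofRealHom k k‖ + ‖A.map Complex.ofRealHom k k‖ := by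
      simpa using norm_add_le (x - A.map Complex.ofRealHom k k) (A.map Complex.ofRealHom k k)
    simp only [Matrix.map_apply, Complex.ofRealHom_eq_coe, Complex.norm_real,
      Real.norm_eq_abs] at h2 hk
    linarith
  exact h1.trans (Finset.single_le_sum (f := fun i => ∑ j, |A i j|)
    (fun i _ => Finset.sum_nonneg fun j _ => abs_nonneg _) (Finset.mem_univ k))

theorem realEigenvalueCount_le {n : ℕ} (A : Matrix (Fin n) (Fin n) ℝ) :
    realEigenvalueCount A ≤ n := by
  simpa [realEigenvalueCount] using A.charpoly.card_roots'

/-- The number of real eigenvalues, with multiplicity, is upper semicontinuous. -/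
theorem le_realEigenvalueCount_of_tendsto {n k : ℕ} {A : ℕ → Matrix (Fin n) (Fin n) ℝ}
    {B : Matrix (Fin n) (Fin n) ℝ} (hA : ∀ i j, Tendsto (fun m => A m i j) atTop (𝓝 (B i j)))
    (hk : ∀ m, k ≤ realEigenvalueCount (A m)) : k ≤ realEigenvalueCount B := by
  have hkn : k ≤ n := (hk 0).trans (realEigenvalueCount_le _)
  choose z hz hre using fun m => (A m).charpoly_monic.exists_complex_roots
    (by simp : (A m).charpoly.natDegree = n) (hk m)
  have hS : Tendsto (fun m => ∑ i, ∑ j, |A m i j|) atTop (𝓝 (∑ i, ∑ j, |B i j|)) :=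
    tendsto_finsetSum _ fun i _ => tendsto_finsetSum _ fun j _ => (hA i j).abs
  obtain ⟨R, hR⟩ := hS.bddAbove_range
  have hmem : ∀ m, z m ∈ Set.univ.pi fun _ : Fin n => Metric.closedBall (0 : ℂ) R := by
    intro m i _
    rw [mem_closedBall_zero_iff]
    refine ((A m).norm_le_sum_abs_of_isRoot ?_).trans (hR ⟨m, rfl⟩)
    rw [hz m, IsRoot, eval_prod]
    exact Finset.prod_eq_zero (Finset.mem_univ i) (by simp)
  -- The eigenvalue tuples are bounded, so a subsequence converges; the limit tuple factors the
  -- limit polynomial, and vanishing of the imaginary part is a closed condition.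
  obtain ⟨w, -, φ, hφ, hw⟩ :=
    (isCompact_univ_pi fun _ : Fin n => isCompact_closedBall (0 : ℂ) R).tendsto_subseq hmem
  have hwi : ∀ i, Tendsto (fun m => z (φ m) i) atTop (𝓝 (w i)) := tendsto_pi_nhds.1 hw
  refine le_card_roots_of_map_eq_prod B.charpoly_monic.ne_zero hkn (z := w) ?_ fun i hi => ?_
  · refine Polynomial.funext fun x => ?_
    have h1 : Tendsto (fun m => ((A (φ m)).charpoly.map Complex.ofRealHom).eval x) atTop
        (𝓝 ((∏ i, (X - C (w i))).eval x)) := by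
      simp only [hz, eval_prod, eval_sub, eval_X, eval_C]
      exact tendsto_finsetProd _ fun i _ => tendsto_const_nhds.sub (hwi i)
    have h2 : Tendsto (fun m => ((A (φ m)).charpoly.map Complex.ofRealHom).eval x) atTop
        (𝓝 ((B.charpoly.map Complex.ofRealHom).eval x)) := by
      simp only [Matrix.eval_map_charpoly]
      refine (Continuous.matrix_det continuous_id).continuousAt.tendsto.comp ?_
      refine tendsto_const_nhds.sub (tendsto_pi_nhds.2 fun i => tendsto_pi_nhds.2 fun j => ?_)
      exact (Complex.continuous_ofReal.tendsto _).comp ((hA i j).comp hφ.tendsto_atTop)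
    exact tendsto_nhds_unique h2 h1
  · have h3 : Tendsto (fun m => (z (φ m) i).im) atTop (𝓝 (w i).im) :=
      (Complex.continuous_im.tendsto _).comp (hwi i)
    simp only [hre _ i hi] at h3
    exact tendsto_nhds_unique h3 tendsto_const_nhds |>.trans rfl

theorem Polynomial.exists_isRoot_of_eval_mul_neg {p : ℝ[X]} {a b : ℝ} (hab : a ≤ b)
    (h : p.eval a * p.eval b < 0) : ∃ x ∈ Set.Ioo a b, p.IsRoot x := by
  have hc : ContinuousOn (fun x => p.eval x) (Set.Icc a b) := p.continuous.continuousOn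
  rcases mul_neg_iff.1 h with ⟨h1, h2⟩ | ⟨h1, h2⟩
  · exact intermediate_value_Ioo' hab hc ⟨h2, h1⟩
  · exact intermediate_value_Ioo hab hc ⟨h1, h2⟩

/-- If the characteristic polynomial of the limit changes sign on `k` disjoint intervals, then
the matrices of the sequence eventually have at least `k` real eigenvalues. -/
theorem eventually_le_realEigenvalueCount {n k : ℕ} {A : ℕ → Matrix (Fin n) (Fin n) ℝ}
    {B : Matrix (Fin n) (Fin n) ℝ} (hA : ∀ i j, Tendsto (fun m => A m i j) atTop (𝓝 (B i j)))
    {a b : Fin k → ℝ} (hab : ∀ t, a t ≤ b t) (hdisj : ∀ s t, s < t → b s ≤ a t)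
    (hsign : ∀ t, B.charpoly.eval (a t) * B.charpoly.eval (b t) < 0) :
    ∀ᶠ m in atTop, k ≤ realEigenvalueCount (A m) := by
  have hev : ∀ x, Tendsto (fun m => (A m).charpoly.eval x) atTop (𝓝 (B.charpoly.eval x)) := by
    intro x
    simp only [Matrix.eval_charpoly]
    refine (Continuous.matrix_det continuous_id).continuousAt.tendsto.comp ?_
    exact tendsto_const_nhds.sub (tendsto_pi_nhds.2 fun i => tendsto_pi_nhds.2 fun j => hA i j)
  have h1 : ∀ᶠ m in atTop, ∀ t, (A m).charpoly.eval (a t) * (A m).charpoly.eval (b t) < 0 :=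
    eventually_all.2 fun t => ((hev _).mul (hev _)).eventually_lt_const (hsign t)
  filter_upwards [h1] with m hm
  choose x hx hroot using fun t => exists_isRoot_of_eval_mul_neg (hab t) (hm t)
  have hmono : StrictMono x := fun s t hst =>
    (hx s).2.trans_le ((hdisj s t hst).trans (hx t).1.le)
  have hsub : Finset.univ.image x ⊆ (A m).charpoly.roots.toFinset := by
    intro y hy
    obtain ⟨t, -, rfl⟩ := Finset.mem_image.1 hy
    simpa [(A m).charpoly_monic.ne_zero] using hroot t
  calc k = (Finset.univ.image x).card := by
        rw [Finset.card_image_of_injective _ hmono.injective]; simp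
    _ ≤ _ := (Finset.card_le_card hsub).trans (Multiset.toFinset_card_le _)

/-! ### Boundary matrices of the qualitative class -/

namespace SignPattern

variable {n : ℕ} {P : SignPattern n}

/-- `B` arises from a matrix in the qualitative class of `P` by replacing entries with zero. -/
def IsDegenerate (P : SignPattern n) (B : Matrix (Fin n) (Fin n) ℝ) : Prop :=
  ∀ i j, B i j ≠ 0 → SignType.sign (B i j) = P i j

/-- The added term has the prescribed sign: it pushes nonzero entries further from zero and fills
the vanished ones. -/
theorem IsDegenerate.add_mem {B : Matrix (Fin n) (Fin n) ℝ} (hB : P.IsDegenerate B) {ε : ℝ}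
    (hε : 0 < ε) : (Matrix.of fun i j => B i j + ε * (P i j : ℝ)) ∈ P.qualitativeClass := by
  intro i j
  have h := hB i j
  simp only [Matrix.of_apply]
  rcases lt_trichotomy (B i j) 0 with h0 | h0 | h0
  · rw [← h h0.ne, sign_neg h0]
    exact sign_neg (by simp; linarith)
  · rw [h0]
    cases P i j <;> simp [sign_pos, sign_neg, hε]
  · rw [← h h0.ne', sign_pos h0]
    exact sign_pos (by simp; linarith)

theorem IsDegenerate.exists_seq {B : Matrix (Fin n) (Fin n) ℝ} (hB : P.IsDegenerate B) :
    ∃ A : ℕ → Matrix (Fin n) (Fin n) ℝ, (∀ m, A m ∈ P.qualitativeClass) ∧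
      ∀ i j, Tendsto (fun m => A m i j) atTop (𝓝 (B i j)) := by
  refine ⟨fun m => Matrix.of fun i j => B i j + 1 / ((m : ℝ) + 1) * (P i j : ℝ),
    fun m => hB.add_mem (by positivity), fun i j => ?_⟩
  simpa using tendsto_const_nhds.add
    ((tendsto_one_div_add_atTop_nhds_zero_nat (𝕜 := ℝ)).mul_const (P i j : ℝ))

theorem IsKConsistent.le_realEigenvalueCount {k : ℕ} (hP : P.IsKConsistent k)
    {B : Matrix (Fin n) (Fin n) ℝ} (hB : P.IsDegenerate B) : k ≤ realEigenvalueCount B := by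
  obtain ⟨A, hA, hlim⟩ := hB.exists_seq
  exact le_realEigenvalueCount_of_tendsto hlim fun m => (hP _ (hA m)).ge

theorem IsKConsistent.le_of_eval_mul_neg {k l : ℕ} (hP : P.IsKConsistent k)
    {B : Matrix (Fin n) (Fin n) ℝ} (hB : P.IsDegenerate B)
    {a b : Fin l → ℝ} (hab : ∀ t, a t ≤ b t) (hdisj : ∀ s t, s < t → b s ≤ a t)
    (hsign : ∀ t, B.charpoly.eval (a t) * B.charpoly.eval (b t) < 0) : l ≤ k := by
  obtain ⟨A, hA, hlim⟩ := hB.exists_seq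
  obtain ⟨m, hm⟩ := (eventually_le_realEigenvalueCount hlim hab hdisj hsign).exists
  exact hm.trans (hP _ (hA m)).le

end SignPattern

/-! ### Lower bounds for `k` from small blocks -/

/-- The matrix with the block `M` in the rows and columns given by `f`, and zeros elsewhere. -/
noncomputable def Matrix.extendByZero {m n : ℕ} (f : Fin m → Fin n)
    (M : Matrix (Fin m) (Fin m) ℝ) : Matrix (Fin n) (Fin n) ℝ :=
  (1 : Matrix (Fin n) (Fin n) ℝ).submatrix id f *
    (M * (1 : Matrix (Fin n) (Fin n) ℝ).submatrix f id)

theorem Matrix.extendByZero_apply {m n : ℕ} {f : Fin m → Fin n} (M : Matrix (Fin m) (Fin m) ℝ)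
    (p q : Fin n) : M.extendByZero f p q =
      ∑ a, ∑ b, if p = f a ∧ f b = q then M a b else 0 := by
  simp only [extendByZero, Matrix.mul_apply, Matrix.submatrix_apply, Matrix.one_apply, id,
    Finset.mul_sum]
  refine Finset.sum_congr rfl fun a _ => Finset.sum_congr rfl fun b _ => ?_
  by_cases h1 : p = f a <;> by_cases h2 : f b = q <;> simp [h1, h2]

theorem Matrix.extendByZero_apply_ne_zero {m n : ℕ} {f : Fin m → Fin n}
    (hf : Function.Injective f) (M : Matrix (Fin m) (Fin m) ℝ) {p q : Fin n}
    (h : M.extendByZero f p q ≠ 0) :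
    ∃ a b, p = f a ∧ q = f b ∧ M.extendByZero f p q = M a b := by
  have h' := h
  rw [extendByZero_apply] at h
  obtain ⟨a, -, ha⟩ := Finset.exists_ne_zero_of_sum_ne_zero h
  obtain ⟨b, -, hb⟩ := Finset.exists_ne_zero_of_sum_ne_zero ha
  have hab : p = f a ∧ f b = q := by
    by_contra hc
    exact hb (if_neg hc)
  obtain ⟨rfl, rfl⟩ := hab
  refine ⟨a, b, rfl, rfl, ?_⟩
  rw [extendByZero_apply, Finset.sum_eq_single a, Finset.sum_eq_single b]
  · simp
  · intro b' _ hb'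
    simp [hf.eq_iff, hb']
  · simp
  · intro a' _ ha'
    simp [hf.eq_iff, Ne.symm ha']
  · simp

/-- The extension is a product `U * (M * V)` with `V * U = 1`, and swapping the factors `U` and `M *
V` changes the characteristic polynomial only by a power of `X`. -/
theorem Matrix.charpoly_extendByZero {m n : ℕ} {f : Fin m → Fin n} (hf : Function.Injective f)
    (M : Matrix (Fin m) (Fin m) ℝ) :
    (M.extendByZero f).charpoly = X ^ (n - m) * M.charpoly := by
  have hle : Fintype.card (Fin m) ≤ Fintype.card (Fin n) := Fintype.card_le_of_injective f hf
  have h1 : (1 : Matrix (Fin n) (Fin n) ℝ).submatrix f id *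
      (1 : Matrix (Fin n) (Fin n) ℝ).submatrix id f = 1 := by
    rw [← Matrix.submatrix_mul _ _ _ _ _ Function.bijective_id, one_mul,
      Matrix.submatrix_one _ hf]
  rw [extendByZero, Matrix.charpoly_mul_comm_of_le _ _ hle, Matrix.mul_assoc, h1, Matrix.mul_one]
  simp

namespace SignPattern

variable {n : ℕ} {P : SignPattern n}

theorem isDegenerate_extendByZero {m : ℕ} {f : Fin m → Fin n} (hf : Function.Injective f)
    {M : Matrix (Fin m) (Fin m) ℝ}
    (hM : ∀ a b, M a b ≠ 0 → SignType.sign (M a b) = P (f a) (f b)) :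
    P.IsDegenerate (M.extendByZero f) := by
  intro p q h
  obtain ⟨a, b, rfl, rfl, hab⟩ := M.extendByZero_apply_ne_zero hf h
  rw [hab] at h ⊢
  exact hM a b h

/-- Padding by zeros contributes a power of `X`. It does not affect the sign changes, because by
`hpos` the endpoints of each interval lie on the same side of 0. -/
theorem IsKConsistent.le_of_block {k l m : ℕ} (hP : P.IsKConsistent k) {f : Fin m → Fin n}
    (hf : Function.Injective f) {M : Matrix (Fin m) (Fin m) ℝ}
    (hM : ∀ a b, M a b ≠ 0 → SignType.sign (M a b) = P (f a) (f b))
    {a b : Fin l → ℝ} (hab : ∀ t, a t ≤ b t) (hdisj : ∀ s t, s < t → b s ≤ a t)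
    (hpos : ∀ t, 0 < a t * b t)
    (hsign : ∀ t, M.charpoly.eval (a t) * M.charpoly.eval (b t) < 0) : l ≤ k := by
  refine hP.le_of_eval_mul_neg (isDegenerate_extendByZero hf hM) hab hdisj fun t => ?_
  rw [Matrix.charpoly_extendByZero hf]
  simp only [eval_mul, eval_pow, eval_X]
  rw [mul_mul_mul_comm, ← mul_pow]
  exact mul_neg_of_pos_of_neg (pow_pos (hpos t) _) (hsign t)

theorem eq_and_ne_zero_of_edgeSign_eq_one {i j : Fin n} (h : P.edgeSign i j = 1) :
    P j i = P i j ∧ P i j ≠ 0 := by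
  unfold edgeSign at h
  revert h
  generalize P i j = s
  generalize P j i = t
  decide +revert

theorem sign_coe_real (s : SignType) : SignType.sign (s : ℝ) = s := by
  cases s <;> simp

theorem sign_two_mul_coe_real (s : SignType) : SignType.sign (2 * (s : ℝ)) = s := by
  rw [sign_mul, sign_coe_real, sign_pos two_pos, one_mul]

theorem coe_real_sq {s : SignType} (h : s ≠ 0) : (s : ℝ) ^ 2 = 1 := by
  cases s <;> simp at h ⊢

theorem IsKConsistent.two_le {k : ℕ} (hP : P.IsKConsistent k) {i j : Fin n}
    (hij : P.IsPositiveEdge i j) : 2 ≤ k := by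
  obtain ⟨h1, h0⟩ := eq_and_ne_zero_of_edgeSign_eq_one hij.2
  have hne := hij.1.1
  have hsq := coe_real_sq h0
  have hev : ∀ x : ℝ, (!![0, (P i j : ℝ); (P i j : ℝ), 0] : Matrix _ _ ℝ).charpoly.eval x =
      x ^ 2 - 1 := by
    intro x
    rw [Matrix.charpoly_fin_two, Matrix.trace_fin_two, Matrix.det_fin_two]
    simp
    linarith
  refine hP.le_of_block (f := ![i, j]) (M := !![0, (P i j : ℝ); (P i j : ℝ), 0])
    (a := ![-2, 1 / 2]) (b := ![-(1 / 2), 2]) ?_ ?_ ?_ ?_ ?_ ?_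
  · intro a b
    fin_cases a <;> fin_cases b <;> simp [hne, hne.symm]
  · intro a b
    fin_cases a <;> fin_cases b <;> simp [h1, sign_coe_real]
  · intro t
    fin_cases t <;> norm_num
  · intro s t
    fin_cases s <;> fin_cases t <;> norm_num
  · intro t
    fin_cases t <;> norm_num
  · intro t
    rw [hev, hev]
    fin_cases t <;> norm_num

theorem IsKConsistent.four_le {k : ℕ} (hP : P.IsKConsistent k)
    (h : P.HasTwoNonadjacentPositiveEdges) : 4 ≤ k := by
  obtain ⟨i, j, p, q, hij, hpq, hip, hiq, hjp, hjq⟩ := h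
  obtain ⟨h1, h0⟩ := eq_and_ne_zero_of_edgeSign_eq_one hij.2
  obtain ⟨h1', h0'⟩ := eq_and_ne_zero_of_edgeSign_eq_one hpq.2
  have hne := hij.1.1
  have hne' := hpq.1.1
  have hsq := coe_real_sq h0
  have hsq' := coe_real_sq h0'
  set s : ℝ := (P i j : ℝ) with hs
  set t : ℝ := (P p q : ℝ) with ht
  -- The factor 2 separates the eigenvalues ±1 and ±2 of the two blocks, so that all four are simple
  -- and give sign changes.
  set M : Matrix (Fin 4) (Fin 4) ℝ :=
    !![0, s, 0, 0; s, 0, 0, 0; 0, 0, 0, 2 * t; 0, 0, 2 * t, 0] with hM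
  have hev : ∀ x : ℝ, M.charpoly.eval x = (x ^ 2 - 1) * (x ^ 2 - 4) := by
    intro x
    rw [Matrix.eval_charpoly, ← hsq, show (4 : ℝ) = 4 * t ^ 2 by rw [hsq']; ring, hM]
    simp [Matrix.det_succ_row_zero, Fin.sum_univ_succ, Fin.succAbove]
    ring
  refine hP.le_of_block (f := ![i, j, p, q]) (M := M)
    (a := ![-3, -(3 / 2), 1 / 2, 3 / 2]) (b := ![-(3 / 2), -(1 / 2), 3 / 2, 3]) ?_ ?_ ?_ ?_ ?_ ?_
  · intro a b
    fin_cases a <;> fin_cases b <;>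
      simp [hne, hne.symm, hne', hne'.symm, hip, hip.symm, hiq, hiq.symm, hjp, hjp.symm,
        hjq, hjq.symm]
  · intro a b
    fin_cases a <;> fin_cases b <;>
      simp [hM, h1, h1', hs, ht, sign_coe_real, sign_two_mul_coe_real]
  · intro t
    fin_cases t <;> norm_num
  · intro s t
    fin_cases s <;> fin_cases t <;> norm_num
  · intro t
    fin_cases t <;> norm_num
  · intro t
    rw [hev, hev]
    fin_cases t <;> norm_num

/-! ### The directed cycle and the upper bound for `k` -/

/-- `τ` rotates the graph of `P`, which is a cycle, by one step. -/
structure IsRotation (P : SignPattern n) (τ : Equiv.Perm (Fin n)) : Prop where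
  adj_iff : ∀ i j, P.graph.Adj i j ↔ j = τ i ∨ i = τ j
  isCycleOn : τ.IsCycleOn ((Finset.univ : Finset (Fin n)) : Set (Fin n))

theorem GraphIsCycle.exists_isRotation (h : P.GraphIsCycle) : ∃ τ, P.IsRotation τ := by
  obtain ⟨hn, ⟨e⟩⟩ := h
  obtain ⟨m, rfl⟩ := Nat.exists_eq_add_of_le' hn
  let g : Equiv.Perm (Fin (m + 3)) := e.toEquiv
  refine ⟨g * finRotate (m + 3) * g⁻¹, fun i j => ?_, ?_⟩
  · obtain ⟨x, rfl⟩ := e.surjective i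
    obtain ⟨y, rfl⟩ := e.surjective j
    have hg : ∀ x, g⁻¹ (e x) = x := e.toEquiv.symm_apply_apply
    rw [e.map_adj_iff, SimpleGraph.cycleGraph_adj]
    simp only [Equiv.Perm.mul_apply, hg, finRotate_apply, sub_eq_iff_eq_add]
    rw [add_comm 1 x, add_comm 1 y, or_comm]
    exact or_congr e.injective.eq_iff.symm e.injective.eq_iff.symm
  · have h1 : (finRotate (m + 3)).IsCycleOn Set.univ := by
      have h : (finRotate (m + 3)).IsCycle := isCycle_finRotate
      convert h.isCycleOn
      ext x
      simp
    simpa using h1.conj (g := g)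

namespace IsRotation

variable {τ : Equiv.Perm (Fin n)}

theorem pow_apply_eq_self_iff (hτ : P.IsRotation τ) (i : Fin n) (k : ℕ) :
    (τ ^ k) i = i ↔ n ∣ k := by
  simpa using hτ.isCycleOn.pow_apply_eq (Finset.mem_univ i) (n := k)

theorem exists_pow_apply_eq (hτ : P.IsRotation τ) (i j : Fin n) : ∃ k < n, (τ ^ k) i = j := by
  simpa using hτ.isCycleOn.exists_pow_eq (Finset.mem_univ i) (Finset.mem_univ j)

theorem apply_ne (hτ : P.IsRotation τ) (hn : 3 ≤ n) (i : Fin n) : τ i ≠ i := by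
  have := hτ.pow_apply_eq_self_iff i 1
  rw [pow_one] at this
  intro h
  have := Nat.le_of_dvd one_pos (this.1 h)
  omega

/-- Keep only the entries of one of the two directed cycles of the digraph of `P`. -/
def directedCycle (P : SignPattern n) (τ : Equiv.Perm (Fin n)) : Matrix (Fin n) (Fin n) ℝ :=
  Matrix.of fun i j => if i = τ j then (P i j : ℝ) else 0

theorem isDegenerate_directedCycle : P.IsDegenerate (directedCycle P τ) := by
  intro i j h
  by_cases hij : i = τ j
  · simp [directedCycle, hij, sign_coe_real]
  · simp [directedCycle, hij] at h

theorem apply_ne_zero (hτ : P.IsRotation τ) (i : Fin n) : P (τ i) i ≠ 0 := by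
  have := ((hτ.adj_iff i (τ i)).2 (Or.inl rfl)).2
  exact right_ne_zero_of_mul this

/-- In the Leibniz expansion a permutation contributes only if it sends each `i` to `i` or `τ i`; on
a single cycle these are just `1` and `τ`. -/
theorem charpoly_directedCycle (hτ : P.IsRotation τ) (hn : 3 ≤ n) :
    ∃ c : ℝ, |c| = 1 ∧ (directedCycle P τ).charpoly = X ^ n - C c := by
  set B := directedCycle P τ with hB
  have hBτ : ∀ i, B (τ i) i = P (τ i) i := fun i => by simp [hB, directedCycle]
  have h1τ : (1 : Equiv.Perm (Fin n)) ≠ τ := by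
    rintro rfl
    exact hτ.apply_ne hn ⟨0, by omega⟩ rfl
  refine ⟨-((Equiv.Perm.sign τ : ℤ) * ∏ i, -(P (τ i) i : ℝ)), ?_, ?_⟩
  · have h1 : ∀ i, |(P (τ i) i : ℝ)| = 1 := fun i => by
      have := hτ.apply_ne_zero i
      revert this
      cases P (τ i) i <;> simp
    rw [abs_neg, abs_mul, Finset.abs_prod]
    simp only [abs_neg, h1, Finset.prod_const_one, mul_one]
    rcases Int.units_eq_one_or (Equiv.Perm.sign τ) with h | h <;> simp [h]
  · rw [Matrix.charpoly, Matrix.det_apply']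
    rw [← Finset.sum_subset (Finset.subset_univ {1, τ}), Finset.sum_pair h1τ]
    · have h2 : ∀ i, B.charmatrix i i = X := fun i => by
        have : ¬ i = τ i := fun h => hτ.apply_ne hn i h.symm
        simp [Matrix.charmatrix_apply_eq, hB, directedCycle, this]
      have h3 : ∀ i, B.charmatrix (τ i) i = C (-(P (τ i) i : ℝ)) := fun i => by
        rw [Matrix.charmatrix_apply_ne _ _ _ (hτ.apply_ne hn i), hBτ, C_neg]
      simp only [Equiv.Perm.one_apply, h2, h3, Equiv.Perm.sign_one, Finset.prod_const,
        Finset.card_univ, Fintype.card_fin, ← map_prod]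
      simp
    · intro σ _ hσ
      by_contra hne
      have hprod : ∀ i, B.charmatrix (σ i) i ≠ 0 := fun i hi => hne (by
        exact mul_eq_zero_of_right _ (Finset.prod_eq_zero (Finset.mem_univ i) hi))
      have hcase : ∀ i, σ i = i ∨ σ i = τ i := by
        intro i
        by_contra hc
        push Not at hc
        refine hprod i ?_
        rw [Matrix.charmatrix_apply_ne _ _ _ hc.1]
        simp [hB, directedCycle, hc.2]
      -- If `σ` fixed `τ i`, it would take the value `τ i` twice.
      have hstep : ∀ i, σ i = τ i → σ (τ i) = τ (τ i) := by
        intro i hi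
        rcases hcase (τ i) with h | h
        · exact absurd (σ.injective (h.trans hi.symm)) (hτ.apply_ne hn i)
        · exact h
      apply hσ
      simp only [Finset.mem_insert, Finset.mem_singleton]
      by_cases hex : ∃ i, σ i = τ i
      · right
        obtain ⟨i, hi⟩ := hex
        ext1 j
        obtain ⟨k, -, rfl⟩ := hτ.exists_pow_apply_eq i j
        clear hσ hne hprod
        induction k with
        | zero => simpa using hi
        | succ k ih => rw [pow_succ', Equiv.Perm.mul_apply]; exact hstep _ ih
      · left
        push Not at hex
        ext1 i
        exact (hcase i).resolve_right (hex i)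

end IsRotation

end SignPattern

/-- The roots are simple by separability, and real ones have absolute value 1; odd powers are
injective on `ℝ`. -/
theorem Polynomial.card_roots_X_pow_sub_C_le {n : ℕ} (hn : n ≠ 0) {c : ℝ} (hc : |c| = 1) :
    (X ^ n - C c).roots.card ≤ 2 ∧ (Odd n → (X ^ n - C c).roots.card ≤ 1) := by
  have hc0 : c ≠ 0 := by rintro rfl; simp at hc
  have hne : (X ^ n - C c : ℝ[X]) ≠ 0 := X_pow_sub_C_ne_zero (Nat.pos_of_ne_zero hn) c
  have hnd := nodup_roots (separable_X_pow_sub_C c (Nat.cast_ne_zero.2 hn) hc0)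
  have hr : ∀ x ∈ (X ^ n - C c).roots, x ^ n = c := by
    intro x hx
    have := (mem_roots hne).1 hx
    simpa [IsRoot, sub_eq_zero] using this
  rw [← Multiset.toFinset_card_of_nodup hnd]
  constructor
  · refine (Finset.card_le_card (t := {1, -1}) fun x hx => ?_).trans Finset.card_le_two
    have h1 : |x| ^ n = 1 := by rw [← abs_pow, hr x (Multiset.mem_toFinset.1 hx), hc]
    have h2 : |x| = 1 := (pow_eq_one_iff_of_nonneg (abs_nonneg x) hn).1 h1
    rcases abs_eq (zero_le_one' ℝ) |>.1 h2 with h | h <;> simp [h]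
  · intro hodd
    refine Finset.card_le_one.2 fun x hx y hy => hodd.pow_injective ?_
    simp only [hr x (Multiset.mem_toFinset.1 hx), hr y (Multiset.mem_toFinset.1 hy)]

namespace SignPattern

variable {n : ℕ} {P : SignPattern n} {τ : Equiv.Perm (Fin n)}

theorem IsKConsistent.le_two {k : ℕ} (hP : P.IsKConsistent k) (hτ : P.IsRotation τ)
    (hn : 3 ≤ n) : k ≤ 2 ∧ (Odd n → k ≤ 1) := by
  obtain ⟨c, hc, hpoly⟩ := hτ.charpoly_directedCycle hn
  have h1 := hP.le_realEigenvalueCount (IsRotation.isDegenerate_directedCycle (τ := τ))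
  rw [realEigenvalueCount, hpoly] at h1
  have h2 := card_roots_X_pow_sub_C_le (by omega : n ≠ 0) hc
  exact ⟨h1.trans h2.1, fun h => h1.trans (h2.2 h)⟩

/-- For real `r`, `(r - B) * (r + B) = r ^ 2 + 1` is invertible, so `r` is no eigenvalue. -/
theorem realEigenvalueCount_eq_zero_of_sq {B : Matrix (Fin n) (Fin n) ℝ} (h : B * B = -1) :
    realEigenvalueCount B = 0 := by
  rw [realEigenvalueCount, Multiset.card_eq_zero]
  refine Multiset.eq_zero_of_forall_notMem fun r hr => ?_
  have h0 : (Matrix.scalar (Fin n) r - B).det = 0 := by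
    rw [← Matrix.eval_charpoly]
    exact (mem_roots B.charpoly_monic.ne_zero).1 hr
  have h1 : (Matrix.scalar (Fin n) r - B) * (Matrix.scalar (Fin n) r + B) =
      Matrix.scalar (Fin n) (r ^ 2 + 1) := by
    have hcomm : B * Matrix.scalar (Fin n) r = Matrix.scalar (Fin n) r * B :=
      ((Matrix.scalar_commute r (fun _ => Commute.all _ _) B).eq).symm
    rw [sub_mul, mul_add, mul_add, hcomm, h, map_add, map_one, pow_two, map_mul]
    abel
  have h2 := congrArg Matrix.det h1
  rw [Matrix.det_mul, h0, zero_mul] at h2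
  have h3 : (r ^ 2 + 1) ^ n ≠ 0 := by positivity
  apply h3
  simpa using h2.symm

/-- A perfect matching by negative edges forces nonreal eigenvalues. -/
theorem IsKConsistent.eq_zero_of_matching {k : ℕ} (hP : P.IsKConsistent k) {μ : Fin n → Fin n}
    (hμ : ∀ i, μ (μ i) = i) (hneg : ∀ i, P.edgeSign i (μ i) = -1) : k = 0 := by
  set B : Matrix (Fin n) (Fin n) ℝ := Matrix.of fun i j => if j = μ i then (P i j : ℝ) else 0
    with hB
  have hdeg : P.IsDegenerate B := by
    intro i j h
    by_cases hij : j = μ i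
    · simp [hB, hij, sign_coe_real]
    · simp [hB, hij] at h
  -- Each matched pair spans a 2 × 2 block with zero diagonal whose off-diagonal entries have
  -- product -1.
  have hsq : B * B = -1 := by
    ext i j
    rw [Matrix.mul_apply, Finset.sum_eq_single (μ i)]
    · by_cases hij : j = i
      · subst hij
        have h1 := hneg j
        unfold edgeSign at h1
        simp only [hB, Matrix.of_apply, hμ, if_true, Matrix.neg_apply, Matrix.one_apply_eq]
        rw [← SignType.coe_mul, h1]
        simp
      · simp [hB, hμ, hij, Matrix.one_apply_ne (Ne.symm hij)]
    · intro p _ hp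
      simp [hB, hp]
    · simp
  have := hP.le_realEigenvalueCount hdeg
  rwa [realEigenvalueCount_eq_zero_of_sq hsq, Nat.le_zero] at this

end SignPattern

/-! ### Maximal signed paths as arcs of the rotation -/

namespace SignPattern

variable {n : ℕ} {P : SignPattern n} {τ : Equiv.Perm (Fin n)}

namespace IsRotation

theorem inv (hτ : P.IsRotation τ) : P.IsRotation τ⁻¹ where
  adj_iff i j := by
    rw [hτ.adj_iff, Equiv.Perm.eq_inv_iff_eq, Equiv.Perm.eq_inv_iff_eq, or_comm, eq_comm (a := i),
      eq_comm (a := j)]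
  isCycleOn := hτ.isCycleOn.inv

/-- A rotation by fewer than `n` steps that fixes a vertex is trivial. -/
theorem eq_zero_of_pow_apply_eq (hτ : P.IsRotation τ) {i : Fin n} {k : ℕ} (hk : k < n)
    (h : (τ ^ k) i = i) : k = 0 :=
  Nat.eq_zero_of_dvd_of_lt ((hτ.pow_apply_eq_self_iff i k).1 h) hk

theorem edgeSign_ne_zero (hτ : P.IsRotation τ) (i : Fin n) : P.edgeSign i (τ i) ≠ 0 :=
  ((hτ.adj_iff i (τ i)).2 (Or.inl rfl)).2

theorem edgeSign_eq_neg_one (hτ : P.IsRotation τ) {i : Fin n} (h : P.edgeSign i (τ i) ≠ 1) :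
    P.edgeSign i (τ i) = -1 := by
  have h0 := hτ.edgeSign_ne_zero i
  revert h h0
  generalize P.edgeSign i (τ i) = s
  decide +revert

theorem isPositiveEdge (hτ : P.IsRotation τ) {i : Fin n} (h : P.edgeSign i (τ i) = 1) :
    P.IsPositiveEdge i (τ i) :=
  ⟨(hτ.adj_iff i (τ i)).2 (Or.inl rfl), h⟩

/-- A path along the cycle that starts in the direction of a rotation keeps that direction. -/
theorem getVert_eq_of_getVert_one (hτ : P.IsRotation τ) {u v : Fin n} {p : P.graph.Walk u v}
    (hp : p.IsPath) (h1 : p.getVert 1 = τ u) :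
    ∀ i, i + 1 ≤ p.length → p.getVert i = (τ ^ i) u ∧ p.getVert (i + 1) = (τ ^ (i + 1)) u := by
  intro i
  induction i with
  | zero => intro _; simp [h1]
  | succ i ih =>
    intro hi
    obtain ⟨ih0, ih1⟩ := ih (by omega)
    refine ⟨ih1, ?_⟩
    have hadj := p.adj_getVert_succ (i := i + 1) (by omega)
    rcases (hτ.adj_iff _ _).1 hadj with h | h
    · rw [h, ih1, pow_succ' τ (i + 1), Equiv.Perm.mul_apply]
    -- Stepping backwards would revisit the vertex before last.
    · rw [ih1, pow_succ', Equiv.Perm.mul_apply, ← ih0, τ.injective.eq_iff] at h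
      have := hp.getVert_injOn (by simp; omega) (by simp; omega) h
      omega

theorem getVert_eq (hτ : P.IsRotation τ) {u v : Fin n} {p : P.graph.Walk u v}
    (hp : p.IsPath) (h1 : p.getVert 1 = τ u) {i : ℕ} (hi : i ≤ p.length) :
    p.getVert i = (τ ^ i) u := by
  rcases i with _ | i
  · simp
  · exact (hτ.getVert_eq_of_getVert_one hp h1 i hi).2

end IsRotation

/-- `E` contains the `l` edges that follow `u` in the direction of `τ`; they all have the sign `s`,
and the edges before and after them do not, unless they run through all the vertices. -/
structure IsArc (P : SignPattern n) (τ : Equiv.Perm (Fin n)) (s : SignType)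
    (E : List (Sym2 (Fin n))) (u : Fin n) (l : ℕ) : Prop where
  pos : 0 < l
  lt : l < n
  mem : ∀ i < l, s((τ ^ i) u, τ ((τ ^ i) u)) ∈ E
  sign_eq : ∀ i < l, P.edgeSign ((τ ^ i) u) (τ ((τ ^ i) u)) = s
  start_ne : l + 1 < n → P.edgeSign (τ⁻¹ u) u ≠ s
  end_ne : l + 1 < n → P.edgeSign ((τ ^ l) u) (τ ((τ ^ l) u)) ≠ s

theorem IsMaximalSignedPathOfSign.isArc (hτ : P.IsRotation τ) {s : SignType} {u v : Fin n}
    {p : P.graph.Walk u v} (h : P.IsMaximalSignedPathOfSign s p) (h1 : p.getVert 1 = τ u) :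
    P.IsArc τ s p.edges u p.length := by
  have hvert : ∀ i ≤ p.length, p.getVert i = (τ ^ i) u := fun i hi => hτ.getVert_eq h.isPath h1 hi
  have hmem : ∀ i < p.length, s((τ ^ i) u, τ ((τ ^ i) u)) ∈ p.edges := by
    intro i hi
    have := p.toSubgraph_adj_getVert hi
    rwa [SimpleGraph.Walk.adj_toSubgraph_iff_mem_edges, hvert i hi.le, hvert (i + 1) hi, pow_succ',
      Equiv.Perm.mul_apply] at this
  have hlast : (τ ^ p.length) u = v := by rw [← hvert _ le_rfl, p.getVert_length]
  refine ⟨h.length_pos, by simpa using h.isPath.length_lt, hmem,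
    fun i hi => h.sign_eq _ _ (hmem i hi), fun hl => ?_, fun hl => ?_⟩
  · refine h.start_maximal _ ((hτ.adj_iff _ _).2 (Or.inl (by simp))) fun hs => ?_
    -- If the preceding vertex were on the path, `i + 1 < n` rotation steps would fix `u`.
    obtain ⟨i, hi, hil⟩ := SimpleGraph.Walk.mem_support_iff_exists_getVert.1 hs
    rw [hvert i hil, Equiv.Perm.eq_inv_iff_eq, ← Equiv.Perm.mul_apply, ← pow_succ'] at hi
    have := hτ.eq_zero_of_pow_apply_eq (by omega) hi
    omega
  · rw [hlast]
    refine h.end_maximal _ ((hτ.adj_iff _ _).2 (Or.inl rfl)) fun hs => ?_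
    obtain ⟨i, hi, hil⟩ := SimpleGraph.Walk.mem_support_iff_exists_getVert.1 hs
    rw [hvert i hil, ← hlast, ← Equiv.Perm.mul_apply, ← pow_succ',
      show p.length + 1 = i + (p.length + 1 - i) by omega, pow_add, Equiv.Perm.mul_apply,
      (τ ^ i).injective.eq_iff] at hi
    have := hτ.eq_zero_of_pow_apply_eq (by omega) hi.symm
    omega

theorem edgeSign_comm (P : SignPattern n) (i j : Fin n) : P.edgeSign i j = P.edgeSign j i :=
  mul_comm _ _

theorem IsMaximalSignedPathOfSign.reverse {s : SignType} {u v : Fin n} {p : P.graph.Walk u v}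
    (h : P.IsMaximalSignedPathOfSign s p) : P.IsMaximalSignedPathOfSign s p.reverse where
  isPath := h.isPath.reverse
  length_pos := by simpa using h.length_pos
  sign_eq a b hab := h.sign_eq a b (by simpa using hab)
  start_maximal w hw hs := by
    rw [edgeSign_comm]
    exact h.end_maximal w hw.symm (by simpa using hs)
  end_maximal w hw hs := by
    rw [edgeSign_comm]
    exact h.start_maximal w hw.symm (by simpa using hs)

/-- A path running against `τ` is reversed, which keeps its edges and its length. -/
theorem IsMaximalSignedPathOfSign.exists_isArc (hτ : P.IsRotation τ) {s : SignType} {u v : Fin n}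
    {p : P.graph.Walk u v} (h : P.IsMaximalSignedPathOfSign s p) :
    ∃ w, P.IsArc τ s p.edges w p.length := by
  have hadj := p.adj_getVert_succ h.length_pos
  rw [p.getVert_zero, zero_add] at hadj
  rcases (hτ.adj_iff _ _).1 hadj with h1 | h1
  · exact ⟨u, h.isArc hτ h1⟩
  · have h2 : p.getVert 1 = τ⁻¹ u := Equiv.Perm.eq_inv_iff_eq.2 h1.symm
    have hvert : ∀ i ≤ p.length, p.getVert i = (τ⁻¹ ^ i) u :=
      fun i hi => hτ.inv.getVert_eq h.isPath h2 hi
    have h3 : p.reverse.getVert 1 = τ v := by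
      have hv : v = (τ⁻¹ ^ p.length) u := by rw [← hvert _ le_rfl, p.getVert_length]
      rw [SimpleGraph.Walk.getVert_reverse, hvert _ (Nat.sub_le _ _)]
      obtain ⟨l, hl⟩ := Nat.exists_eq_add_of_lt h.length_pos
      rw [zero_add] at hl
      rw [hl, pow_succ', Equiv.Perm.mul_apply] at hv
      rw [← Equiv.Perm.inv_eq_iff_eq, hl, Nat.add_sub_cancel]
      exact hv.symm
    have := h.reverse.isArc hτ h3
    refine ⟨v, ?_⟩
    rw [SimpleGraph.Walk.length_reverse] at this
    exact ⟨this.pos, this.lt, fun i hi => by simpa using this.mem i hi, this.sign_eq,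
      this.start_ne, this.end_ne⟩

namespace IsArc

variable {s : SignType} {E : List (Sym2 (Fin n))} {u : Fin n} {l : ℕ}

theorem mem_start (h : P.IsArc τ s E u l) : s(u, τ u) ∈ E := by simpa using h.mem 0 h.pos

theorem sign_start (h : P.IsArc τ s E u l) : P.edgeSign u (τ u) = s := by
  simpa using h.sign_eq 0 h.pos

/-- If the edges of an arc run through all the vertices, then they miss at most one edge. -/
theorem exists_lt_of_ne (h : P.IsArc τ s E u l) (hτ : P.IsRotation τ) (hl : ¬ l + 1 < n)
    {j : Fin n} (hj : j ≠ τ⁻¹ u) : ∃ i < l, (τ ^ i) u = j := by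
  obtain ⟨k, hk, rfl⟩ := hτ.exists_pow_apply_eq u j
  have hlt := h.lt
  refine ⟨k, ?_, rfl⟩
  by_contra hc
  apply hj
  rw [Equiv.Perm.eq_inv_iff_eq, ← Equiv.Perm.mul_apply, ← pow_succ',
    hτ.pow_apply_eq_self_iff, show k + 1 = n by omega]

/-- If all edges were negative, each arc could be prolonged until it missed only one edge. Two arcs
would then miss at most two of the `n ≥ 3` edges, and share another. -/
theorem exists_edgeSign_eq_one {E' : List (Sym2 (Fin n))} {s' : SignType} {u' : Fin n} {l' : ℕ}
    (h : P.IsArc τ s E u l) (h' : P.IsArc τ s' E' u' l') (hτ : P.IsRotation τ) (hn : 3 ≤ n)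
    (hd : E.Disjoint E') : ∃ a, P.edgeSign a (τ a) = 1 := by
  by_contra! hc
  have hneg := fun i => hτ.edgeSign_eq_neg_one (hc i)
  have key : ∀ {E : List (Sym2 (Fin n))} {s : SignType} {u : Fin n} {l : ℕ},
      P.IsArc τ s E u l → ¬ l + 1 < n := by
    intro E s u l h hl
    apply h.start_ne hl
    rw [← h.sign_start, hneg u]
    simpa using hneg (τ⁻¹ u)
  obtain ⟨j, -, hj⟩ := Finset.exists_mem_notMem_of_card_lt_card
    (s := {τ⁻¹ u, τ⁻¹ u'}) (t := (Finset.univ : Finset (Fin n)))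
    (Finset.card_le_two.trans_lt (by simp; omega))
  simp only [Finset.mem_insert, Finset.mem_singleton, not_or] at hj
  obtain ⟨i, hi, hij⟩ := h.exists_lt_of_ne hτ (key h) hj.1
  obtain ⟨i', hi', hij'⟩ := h'.exists_lt_of_ne hτ (key h') hj.2
  have hm := h.mem i hi
  have hm' := h'.mem i' hi'
  rw [hij] at hm
  rw [hij'] at hm'
  exact hd hm hm'

/-- If there are just two positive edges, and they are adjacent, then an arc of odd length begins
with the edge after them. -/
theorem start_eq (h : P.IsArc τ s E u l) (hs : s = 1 ∨ s = -1) (hodd : Odd l)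
    (hτ : P.IsRotation τ) (hn : 4 ≤ n) {a : Fin n}
    (ha : ∀ j, P.edgeSign j (τ j) = 1 ↔ j = a ∨ j = τ a) : u = τ (τ a) := by
  have h1 : τ a ≠ a := hτ.apply_ne (by omega) a
  have h2 : τ (τ a) ≠ a := fun h => by
    have := hτ.eq_zero_of_pow_apply_eq (k := 2) (by omega) (i := a) (by simpa [pow_two] using h)
    omega
  have hpa : P.edgeSign a (τ a) = 1 := (ha a).2 (Or.inl rfl)
  have hpa' : P.edgeSign (τ a) (τ (τ a)) = 1 := (ha (τ a)).2 (Or.inr rfl)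
  rcases hs with rfl | rfl
  -- A positive arc of length 1 could be prolonged by the other positive edge; one of length at
  -- least 3 would need three positive edges.
  · exfalso
    have hu := (ha u).1 h.sign_start
    by_cases hl : l = 1
    · subst hl
      have h3 := h.start_ne (by omega)
      have h4 := h.end_ne (by omega)
      rw [pow_one] at h4
      rcases hu with rfl | rfl
      · exact h4 hpa'
      · exact h3 (by simpa using hpa)
    · have hl3 : 2 < l := by
        obtain ⟨m, rfl⟩ := hodd
        omega
      have h3 := (ha _).1 (h.sign_eq 1 (by omega))
      have h4 := (ha _).1 (h.sign_eq 2 hl3)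
      simp only [pow_one, pow_two, Equiv.Perm.mul_apply] at h3 h4
      rcases hu with rfl | rfl
      · rcases h4 with h | h
        · exact h2 h
        · exact h1 (τ.injective h)
      · rcases h3 with h | h
        · exact h2 h
        · exact h1 (τ.injective h)
  · have hu : P.edgeSign u (τ u) ≠ 1 := by rw [h.sign_start]; decide
    rw [Ne, ha, not_or] at hu
    -- Either the edge before a negative arc is positive, and must be the second of the two, or the
    -- arc misses only one edge and leaves no room for two positive ones.
    by_cases hl : l + 1 < n
    · have h3 : P.edgeSign (τ⁻¹ u) (τ (τ⁻¹ u)) = 1 := by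
        by_contra hc
        exact h.start_ne hl (by simpa using hτ.edgeSign_eq_neg_one hc)
      rw [ha, Equiv.Perm.inv_eq_iff_eq, Equiv.Perm.inv_eq_iff_eq] at h3
      exact h3.resolve_left hu.2
    · exfalso
      have key : ∀ j, P.edgeSign j (τ j) = 1 → j = τ⁻¹ u := by
        intro j hj
        by_contra hc
        obtain ⟨i, hi, rfl⟩ := h.exists_lt_of_ne hτ hl hc
        rw [h.sign_eq i hi] at hj
        exact absurd hj (by decide)
      exact h1 ((key _ hpa').trans (key _ hpa).symm)

end IsArc

theorem HasTwoOddMaximalSignedPaths.exists_isArc (hτ : P.IsRotation τ)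
    (h : P.HasTwoOddMaximalSignedPaths) : ∃ s s' E E' u u' l l',
      P.IsArc τ s E u l ∧ P.IsArc τ s' E' u' l' ∧ (s = 1 ∨ s = -1) ∧ (s' = 1 ∨ s' = -1) ∧
      Odd l ∧ Odd l' ∧ E.Disjoint E' := by
  obtain ⟨u, v, u', v', p, q, hp, hq, hpo, hqo, hd⟩ := h
  have key : ∀ {u v} {p : P.graph.Walk u v}, P.IsMaximalSignedPath p →
      ∃ s, (s = 1 ∨ s = -1) ∧ ∃ w, P.IsArc τ s p.edges w p.length := by
    rintro u v p (h | h)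
    · exact ⟨1, Or.inl rfl, h.exists_isArc hτ⟩
    · exact ⟨-1, Or.inr rfl, h.exists_isArc hτ⟩
  obtain ⟨s, hs, w, hw⟩ := key hp
  obtain ⟨s', hs', w', hw'⟩ := key hq
  exact ⟨s, s', _, _, w, w', _, _, hw, hw', hs, hs', hpo, hqo, hd⟩

theorem HasTwoOddMaximalSignedPaths.exists_edgeSign_eq_one (hτ : P.IsRotation τ) (hn : 3 ≤ n)
    (h : P.HasTwoOddMaximalSignedPaths) : ∃ a, P.edgeSign a (τ a) = 1 := by
  obtain ⟨s, s', E, E', u, u', l, l', h1, h2, -, -, -, -, hd⟩ := h.exists_isArc hτ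
  exact h1.exists_edgeSign_eq_one h2 hτ hn hd

/-! ### The single positive edge and the matching that avoids it -/

/-- On a cycle of even length, two maximal signed paths of odd length and no two nonadjacent
positive edges leave room for a single positive edge only. -/
theorem HasTwoOddMaximalSignedPaths.exists_unique_positive (hτ : P.IsRotation τ) (hn : 3 ≤ n)
    (heven : Even n) (h : P.HasTwoOddMaximalSignedPaths)
    (hadj : ¬ P.HasTwoNonadjacentPositiveEdges) :
    ∃ a, P.edgeSign a (τ a) = 1 ∧ ∀ j, P.edgeSign j (τ j) = 1 → j = a := by
  have hn4 : 4 ≤ n := by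
    obtain ⟨m, rfl⟩ := heven
    omega
  have hpair : ∀ a b, P.edgeSign a (τ a) = 1 → P.edgeSign b (τ b) = 1 →
      a = b ∨ a = τ b ∨ b = τ a := by
    intro a b ha hb
    by_contra! hc
    exact hadj ⟨a, τ a, b, τ b, hτ.isPositiveEdge ha, hτ.isPositiveEdge hb, hc.1, hc.2.1,
      hc.2.2.symm, fun h => hc.1 (τ.injective h)⟩
  have hnot : ∀ a, P.edgeSign a (τ a) = 1 → P.edgeSign (τ a) (τ (τ a)) ≠ 1 := by
    intro a ha hb
    have hall : ∀ j, P.edgeSign j (τ j) = 1 ↔ j = a ∨ j = τ a := by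
      refine fun j => ⟨fun hj => ?_, by rintro (rfl | rfl) <;> assumption⟩
      rcases hpair j a hj ha with h1 | h1 | h1
      · exact Or.inl h1
      · exact Or.inr h1
      rcases hpair j (τ a) hj hb with h2 | h2 | h2
      · exact Or.inr h2
      -- Three distinct, pairwise adjacent edges would close up to a triangle.
      · exfalso
        have h3 : (τ ^ 3) j = j := by
          rw [pow_succ, pow_two, Equiv.Perm.mul_apply, Equiv.Perm.mul_apply, ← h1, ← h2]
        have := hτ.eq_zero_of_pow_apply_eq (by omega) h3
        omega
      · exact Or.inl (τ.injective h2.symm)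
    obtain ⟨s, s', E, E', u, u', l, l', h1, h2, hs, hs', hl, hl', hd⟩ := h.exists_isArc hτ
    have hm := h1.mem_start
    have hm' := h2.mem_start
    rw [h1.start_eq hs hl hτ hn4 hall] at hm
    rw [h2.start_eq hs' hl' hτ hn4 hall] at hm'
    exact hd hm hm'
  obtain ⟨a, ha⟩ := h.exists_edgeSign_eq_one hτ hn
  refine ⟨a, ha, fun j hj => ?_⟩
  rcases hpair j a hj ha with h1 | rfl | rfl
  · exact h1
  · exact absurd hj (hnot _ ha)
  · exact absurd ha (hnot _ hj)

/-- An even cycle has a perfect matching that avoids a given edge. -/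
theorem IsRotation.exists_matching (hτ : P.IsRotation τ) (heven : Even n) (a : Fin n) :
    ∃ μ : Fin n → Fin n, (∀ i, μ (μ i) = i) ∧
      ∀ i, (μ i = τ i ∧ i ≠ a) ∨ (τ (μ i) = i ∧ μ i ≠ a) := by
  classical
  -- The class of `a` in the 2-colouring of the cycle, which is proper because `n` is even. Its
  -- vertices are matched backwards and the others forwards, so the edge from `a` to `τ a` is not
  -- used.
  let c : Fin n → Prop := fun i => ∃ k, Even k ∧ (τ ^ k) a = i
  have hca : c a := ⟨0, by simp, by simp⟩
  have hc : ∀ i, c (τ i) ↔ ¬ c i := by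
    intro i
    constructor
    · rintro ⟨k, hk, hki⟩ ⟨m, hm, rfl⟩
      rw [← Equiv.Perm.mul_apply, ← pow_succ'] at hki
      have h1 := (hτ.isCycleOn.pow_apply_eq_pow_apply (Finset.mem_univ a)).1 hki
      rw [Finset.card_univ, Fintype.card_fin] at h1
      have h2 : k ≡ m + 1 [MOD 2] := h1.of_dvd heven.two_dvd
      rw [Nat.even_iff] at hk hm
      unfold Nat.ModEq at h2
      omega
    · intro h
      obtain ⟨k, -, rfl⟩ := hτ.exists_pow_apply_eq a i
      refine ⟨k + 1, ?_, by rw [pow_succ', Equiv.Perm.mul_apply]⟩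
      rw [Nat.even_add_one]
      exact fun hk => h ⟨k, hk, rfl⟩
  have hinv : ∀ i, τ (τ⁻¹ i) = i := fun i => by simp
  have hc' : ∀ i, c (τ⁻¹ i) ↔ ¬ c i := by
    intro i
    have := hc (τ⁻¹ i)
    rw [hinv] at this
    rw [this, not_not]
  refine ⟨fun i => if c i then τ⁻¹ i else τ i, fun i => ?_, fun i => ?_⟩
  · by_cases h : c i
    · have h' : ¬ c (τ⁻¹ i) := fun h0 => (hc' i).1 h0 h
      simp only [h, h', if_true, if_false, hinv]
    · have h' : c (τ i) := (hc i).2 h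
      simp [h, h']
  · by_cases h : c i
    · right
      have h' : ¬ c (τ⁻¹ i) := fun h0 => (hc' i).1 h0 h
      simp only [h, if_true, hinv, true_and]
      exact fun h0 => h' (h0 ▸ hca)
    · left
      simp only [h, if_false, true_and]
      exact fun h0 => h (h0 ▸ hca)

theorem IsKConsistent.eq_zero_of_unique_positive {k : ℕ} (hP : P.IsKConsistent k)
    (hτ : P.IsRotation τ) (heven : Even n) {a : Fin n}
    (ha : ∀ j, P.edgeSign j (τ j) = 1 → j = a) : k = 0 := by
  obtain ⟨μ, hμ, hμa⟩ := hτ.exists_matching heven a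
  refine hP.eq_zero_of_matching hμ fun i => ?_
  rcases hμa i with ⟨h1, h2⟩ | ⟨h1, h2⟩
  · rw [h1]
    exact hτ.edgeSign_eq_neg_one fun h => h2 (ha i h)
  · have := hτ.edgeSign_eq_neg_one fun h => h2 (ha (μ i) h)
    rwa [h1, edgeSign_comm] at this

end SignPattern

theorem theorem4p2 (n : ℕ) (P : SignPattern n)
    (hirr : P.IsIrreducible)
    (hsymm : P.IsCombinatoriallySymmetric)
    (hdiag : P.HasZeroDiagonal)
    (hcycle : P.GraphIsCycle)
    (h : P.HasTwoNonadjacentPositiveEdges ∨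
      P.HasTwoOddMaximalSignedPaths ∨
      (Odd n ∧ ∃ i j : Fin n, P.IsPositiveEdge i j)) :
    ¬ P.IsConsistent := by
  rintro ⟨k, -, hk⟩
  have hn := hcycle.1
  obtain ⟨τ, hτ⟩ := hcycle.exists_isRotation
  have hle := hk.le_two hτ hn
  have hadj : ¬ P.HasTwoNonadjacentPositiveEdges := fun h => by
    have := hk.four_le h
    omega
  have hodd : ∀ i j, P.IsPositiveEdge i j → ¬ Odd n := fun i j hij hodd => by
    have := hk.two_le hij
    have := hle.2 hodd
    omega
  rcases h with h | h | ⟨hno, i, j, hij⟩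
  · exact hadj h
  · obtain ⟨b, hb⟩ := h.exists_edgeSign_eq_one hτ hn
    have heven : Even n := Nat.not_odd_iff_even.1 (hodd _ _ (hτ.isPositiveEdge hb))
    obtain ⟨a, ha, huniq⟩ := h.exists_unique_positive hτ hn heven hadj
    have h0 := hk.eq_zero_of_unique_positive hτ heven huniq
    have h2 := hk.two_le (hτ.isPositiveEdge ha)
    omega
  · exact hodd i j hij hno
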